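/- **Setting.** Let $X$ be a locally compact metric space. A *piecewise continuous map* (PCM) is a map $f:X\to X$ together with a finite partition $A_0,\dots,A_{n-1}$ of $X$ such that each $f|_{A_i}$ extends to a continuous map $f_i:\overline{A_i}\to X$; the partition is assumed minimal, i.e. no two pieces can be merged with this property kept. Put $D=\bigcup_{i\ne j}\overline{A_i}\cap\overline{A_j}$. A map $g:X\to X$ is *adjoint with* $f$ if there are a partition $B_0,\dots,B_{n-1}$ of $X$ and a permutation $\phi$ of the indices such that $A_i\setminus D=B_{\phi(i)}\setminus D$, $B_{\phi(i)}\subset\overline{A_i}$ and $g=f_i$ on $B_{\phi(i)}$ for all $i$. For a self-map $h$ and a set $A$, let $\mathrm{Inv}_h(A)$ (resp. $\mathrm{Inv}^-_h(A)$) be the set of $x\in A$ lying on a full $h$-orbit $(x_k)_{k\in\mathbb Z}$ (resp. having a backward $h$-orbit $(x_k)_{k\le 0}$) in $A$ with $x_0=x$. A compact $N\subset X$ is a *compatible isolating neighborhood* of $f$ if $\mathrm{Inv}_f(N)\subset\mathrm{int}\,N$ and $\partial N\cap D\cap\mathrm{Inv}^-_g(N)=\emptyset$ for every $g$ adjoint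 with $f$. Let $\tau:X\to\{0,\dots,n-1\}^{\mathbb N_0}$ (product topology), $\tau(x)_k=i$ iff $f^k(x)\in A_i$, be the coding map, $G=\{(x,\tau(x)):x\in X\}$ its graph, and $\widehat f:\overline G\to\overline G$ the continuous extension of $(x,\tau(x))\mapsto(f(x),\tau(f(x)))$ to the closure of $G$ in $X\times\{0,\dots,n-1\}^{\mathbb N_0}$; explicitly $\widehat f(x,s)=(f_{s_0}(x),(s_{k+1})_k)$. Let $\widehat N$ be the closure of $\{(x,\tau(x)):x\in N\}$ in $\overline G$. For a continuous $h:Y\to Y$, an *index pair* for $S\subset Y$ consists of compact sets $P_0\subset P_1\subset Y$ with (1) $S=\mathrm{Inv}_h(\overline{P_1\setminus P_0})\subset\mathrm{int}(P_1\setminus P_0)$; (2) $x\in P_0\Rightarrow h(x)\notin P_1\setminus P_0$; (3) $x\in P_1,\ h(x)\notin P_1\Rightarrow x\in P_0$. The index map $h_P$ of the pointed space $P_1/P_0$ (where $P_1/\emptyset$ is $P_1$ with a disjoint base point) sends $[x]$ to $[h(x)]$ if $h(x)\in P_1$ and to the base point otherwise. The Szymczak category over a category $\mathcal K$ has as objects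 the pairs $(K,k)$ with $k:K\to K$ in $\mathcal K$; its morphisms $(K,k)\to(K',k')$ are classes $[\varphi,m]$ of pairs of a morphism $\varphi$ with $\varphi k=k'\varphi$ and an integer $m\ge0$, where $(\varphi_1,m_1)\sim(\varphi_2,m_2)$ iff $\varphi_2k^{m_1+l}=\varphi_1k^{m_2+l}$ for some $l\ge0$, and $[\varphi',m']\circ[\varphi,m]=[\varphi'\varphi,m'+m]$. The Conley index of $S$ is the isomorphism class of $(P_1/P_0,h_P)$, over all index pairs $P$ for $S$, in the Szymczak category over the homotopy category of pointed spaces; it is *trivial* if it is the isomorphism class of the one-point space with its identity. **Proposition (Ważewski property).** Let $f$ be a PCM, $N$ a compatible isolating neighborhood of $f$, and let $C(N)$ be the Conley index of $\mathrm{Inv}_{\widehat f}(\widehat N)$ for $\widehat f$. If $C(N)$ is nontrivial, then at least one of the following holds: 1. $\mathrm{Inv}_f(N)\neq\emptyset$; 2. there is some $g\neq f$ adjoint with $f$ such that $\mathrm{Inv}_g(N)\neq\emptyset$. -/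

import Mathlib

universe u v

namespace ConleyPCM

open CategoryTheory

/-! ## Invariant sets of a self-map -/

/-- `Inv_h(A)`: the points of `A` through which there is a full `h`-orbit contained in `A`. -/
def Inv {Y : Type u} (h : Y → Y) (A : Set Y) : Set Y :=
  {x | ∃ o : ℤ → Y, (∀ k, o k ∈ A) ∧ o 0 = x ∧ ∀ k, h (o k) = o (k + 1)}

/-- `Inv⁻_h(A)`: the points of `A` with an infinite backward `h`-orbit contained in `A`;
`o k` is the point at time `-k`. -/
def InvMinus {Y : Type u} (h : Y → Y) (A : Set Y) : Set Y :=
  {x | ∃ o : ℕ → Y, (∀ k, o k ∈ A) ∧ o 0 = x ∧ ∀ k, h (o (k + 1)) = o k}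

/-! ## The Szymczak category of a category -/

/-- Objects of the Szymczak category over `K`: objects of `K` with an endomorphism. -/
structure Sz (K : Type u) [Category.{v} K] where
  obj : K
  endo : End obj

namespace Sz

variable {K : Type u} [Category.{v} K]

/-- Equivariant morphisms, i.e. the morphisms `(X, f) ⟶ (X', f')` of `Endo(K)`. -/
@[ext]
structure Equivariant (A B : Sz K) : Type v where
  hom : A.obj ⟶ B.obj
  comm : A.endo.asHom ≫ hom = hom ≫ B.endo.asHom

/-- The iterate `f ^ n` of the endomorphism of `A = (X, f)`, as a morphism. -/
def iter (A : Sz K) (n : ℕ) : A.obj ⟶ A.obj := (A.endo ^ n).asHom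

theorem iter_zero (A : Sz K) : A.iter 0 = 𝟙 A.obj := rfl

theorem iter_succ (A : Sz K) (n : ℕ) : A.iter (n + 1) = A.endo.asHom ≫ A.iter n := by
  unfold iter
  rw [pow_succ]
  rfl

theorem iter_add (A : Sz K) (m n : ℕ) : A.iter (m + n) = A.iter m ≫ A.iter n := by
  unfold iter
  rw [add_comm, pow_add]
  rfl

theorem iter_comp {A B : Sz K} (φ : Equivariant A B) (n : ℕ) :
    A.iter n ≫ φ.hom = φ.hom ≫ B.iter n := by
  induction n with
  | zero => simp [iter_zero]
  | succ n ih =>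
    rw [iter_succ, iter_succ, Category.assoc, ih, ← Category.assoc, φ.comm, Category.assoc]

/-- `(φ₁, n₁) ∼ (φ₂, n₂)` iff `φ₂ ∘ f ^ (n₁ + k) = φ₁ ∘ f ^ (n₂ + k)` for some `k`. -/
def rel (A B : Sz K) (p q : Equivariant A B × ℕ) : Prop :=
  ∃ k : ℕ, A.iter (p.2 + k) ≫ q.1.hom = A.iter (q.2 + k) ≫ p.1.hom

theorem rel_of_le {A B : Sz K} {p q : Equivariant A B × ℕ} {k l : ℕ} (hkl : k ≤ l)
    (h : A.iter (p.2 + k) ≫ q.1.hom = A.iter (q.2 + k) ≫ p.1.hom) :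
    A.iter (p.2 + l) ≫ q.1.hom = A.iter (q.2 + l) ≫ p.1.hom := by
  obtain ⟨d, rfl⟩ := Nat.exists_eq_add_of_le hkl
  rw [show p.2 + (k + d) = d + (p.2 + k) by ring, show q.2 + (k + d) = d + (q.2 + k) by ring,
    iter_add A d, iter_add A d, Category.assoc, Category.assoc, h]

theorem rel_equivalence (A B : Sz K) : Equivalence (rel A B) where
  refl p := ⟨0, rfl⟩
  symm := fun ⟨k, h⟩ => ⟨k, h.symm⟩
  trans := by
    rintro p q r ⟨k, h⟩ ⟨l, h'⟩
    refine ⟨q.2 + (k + l), ?_⟩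
    have h1 := rel_of_le (Nat.le_add_right k l) h
    have h2 := rel_of_le (Nat.le_add_left l k) h'
    generalize k + l = m at h1 h2
    rw [iter_add A p.2, Category.assoc, h2, ← Category.assoc, ← iter_add,
      show p.2 + (r.2 + m) = r.2 + (p.2 + m) by ring, iter_add A r.2, Category.assoc, h1,
      ← Category.assoc, ← iter_add]

def setoid (A B : Sz K) : Setoid (Equivariant A B × ℕ) := ⟨rel A B, rel_equivalence A B⟩

/-- Morphisms of the Szymczak category: classes `[φ, n]`. -/
def Hom (A B : Sz K) : Type v := _root_.Quotient (setoid A B)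

def Equivariant.id (A : Sz K) : Equivariant A A := ⟨𝟙 A.obj, by simp⟩

def Equivariant.comp {A B C : Sz K} (φ : Equivariant A B) (ψ : Equivariant B C) :
    Equivariant A C :=
  ⟨φ.hom ≫ ψ.hom, by
    rw [← Category.assoc, φ.comm, Category.assoc, ψ.comm, Category.assoc]⟩

/-- `[ψ, m] ∘ [φ, n] = [ψ ∘ φ, m + n]`. -/
def Hom.comp {A B C : Sz K} : Hom A B → Hom B C → Hom A C :=
  _root_.Quotient.map₂ (fun p q => (p.1.comp q.1, q.2 + p.2)) (by
    rintro ⟨φ, n⟩ ⟨φ', n'⟩ ⟨k, h⟩ ⟨ψ, m⟩ ⟨ψ', m'⟩ ⟨l, h'⟩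
    refine ⟨k + l, ?_⟩
    simp only [Equivariant.comp] at h h' ⊢
    calc A.iter (m + n + (k + l)) ≫ φ'.hom ≫ ψ'.hom
        = A.iter (m + l) ≫ (A.iter (n + k) ≫ φ'.hom) ≫ ψ'.hom := by
          rw [show m + n + (k + l) = (m + l) + (n + k) by ring, iter_add]
          simp only [Category.assoc]
      _ = A.iter (n' + k) ≫ (A.iter (m + l) ≫ φ.hom) ≫ ψ'.hom := by
          rw [h, ← Category.assoc, ← Category.assoc, ← iter_add, add_comm, iter_add]
          simp only [Category.assoc]
      _ = A.iter (n' + k) ≫ φ.hom ≫ B.iter (m' + l) ≫ ψ.hom := by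
          rw [iter_comp, Category.assoc, h']
      _ = A.iter (n' + k) ≫ (A.iter (m' + l) ≫ φ.hom) ≫ ψ.hom := by
          rw [iter_comp φ, Category.assoc]
      _ = A.iter (m' + n' + (k + l)) ≫ φ.hom ≫ ψ.hom := by
          rw [show m' + n' + (k + l) = (n' + k) + (m' + l) by ring,
            iter_add A (n' + k)]
          simp only [Category.assoc])

instance : Category (Sz K) where
  Hom A B := Hom A B
  id A := _root_.Quotient.mk _ (Equivariant.id A, 0)
  comp := Hom.comp
  id_comp := by
    rintro A B ⟨φ, n⟩
    refine _root_.Quotient.sound ⟨0, ?_⟩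
    simp [Equivariant.comp, Equivariant.id]
  comp_id := by
    rintro A B ⟨φ, n⟩
    refine _root_.Quotient.sound ⟨0, ?_⟩
    simp [Equivariant.comp, Equivariant.id]
  assoc := by
    rintro A B C D ⟨φ, n⟩ ⟨ψ, m⟩ ⟨χ, l⟩
    refine _root_.Quotient.sound ⟨0, ?_⟩
    simp [Equivariant.comp, add_assoc]

end Sz

/-! ## The homotopy category of pointed spaces -/

/-- Pointed topological spaces. -/
structure PTop where
  carrier : Type u
  [top : TopologicalSpace carrier]
  pt : carrier

attribute [instance] PTop.top

/-- Base-point preserving continuous maps. -/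
structure PTop.Hom (A B : PTop.{u}) where
  toMap : C(A.carrier, B.carrier)
  map_pt : toMap A.pt = B.pt

instance : Category PTop.{u} where
  Hom A B := PTop.Hom A B
  id A := ⟨ContinuousMap.id _, rfl⟩
  comp f g := ⟨g.toMap.comp f.toMap, by simp [f.map_pt, g.map_pt]⟩

/-- Base-point preserving homotopy of pointed maps. -/
def pointedHomotopic : HomRel PTop.{u} := fun A _ f g =>
  ContinuousMap.HomotopicRel (PTop.Hom.toMap f) (PTop.Hom.toMap g) {A.pt}

instance : Congruence pointedHomotopic.{u} where
  equivalence := ⟨fun _ => .refl _, fun h => h.symm, fun h h' => h.trans h'⟩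
  comp_left := by
    rintro A B C f g g' ⟨H⟩
    refine ⟨⟨⟨⟨fun p => H (p.1, f.toMap p.2), by fun_prop⟩, ?_, ?_⟩, ?_⟩⟩
    · intro x; exact H.apply_zero _
    · intro x; exact H.apply_one _
    · intro t x hx
      have hx' : f.toMap x ∈ ({B.pt} : Set B.carrier) := by
        rw [Set.mem_singleton_iff.1 hx]; exact f.map_pt
      exact H.eq_fst t hx'
  comp_right := by
    intro A B C f f' g h
    exact h.comp_continuousMap g.toMap

/-- The homotopy category of pointed topological spaces. -/
abbrev HoPTop : Type (u + 1) := CategoryTheory.Quotient pointedHomotopic.{u}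

/-- The object of the Szymczak category over the pointed homotopy category that is
given by a pointed self-map. -/
def szObj (A : PTop.{u}) (f : A ⟶ A) : Sz HoPTop.{u} :=
  ⟨(Quotient.functor pointedHomotopic).obj A, (Quotient.functor pointedHomotopic).map f⟩

/-- The one-point pointed space. -/
def onePoint : PTop.{u} := ⟨PUnit.{u + 1}, PUnit.unit⟩

/-- The trivial object: the one-point space with its identity. -/
def trivialObj : Sz HoPTop.{u} := szObj onePoint (𝟙 onePoint)

/-! ## Index pairs and the Conley index of a continuous map -/

section Index

variable {Y : Type u} [TopologicalSpace Y]

/-- `(P1, P0)` is an index pair for the invariant set `S` of `h`. -/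
structure IndexPair (h : C(Y, Y)) (S : Set Y) where
  P1 : Set Y
  P0 : Set Y
  compact_P1 : IsCompact P1
  compact_P0 : IsCompact P0
  subset : P0 ⊆ P1
  inv_eq : Inv h (closure (P1 \ P0)) = S
  isolating : S ⊆ interior (P1 \ P0)
  exit_invariant : ∀ x ∈ P0, h x ∉ P1 \ P0
  exit : ∀ x ∈ P1, h x ∉ P1 → x ∈ P0

/-- The points of `P1 ⊔ {*}` that are collapsed to the base point of `P1 / P0`. -/
def IsBase (P1 P0 : Set Y) : P1 ⊕ PUnit.{1} → Prop :=
  Sum.elim (fun x => x.1 ∈ P0) (fun _ => True)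

/-- Collapse `P0 ⊔ {*}` in `P1 ⊔ {*}` to a point. -/
def collapse (P1 P0 : Set Y) : Setoid (P1 ⊕ PUnit.{1}) where
  r a b := a = b ∨ (IsBase P1 P0 a ∧ IsBase P1 P0 b)
  iseqv :=
    { refl := fun _ => Or.inl rfl
      symm := by
        rintro a b (rfl | h)
        · exact Or.inl rfl
        · exact Or.inr h.symm
      trans := by
        rintro a b c (rfl | h) (rfl | h')
        · exact Or.inl rfl
        · exact Or.inr h'
        · exact Or.inr h
        · exact Or.inr ⟨h.1, h'.2⟩ }

/-- The pointed quotient space `P1 / P0`, with the usual convention that `P1 / ∅` is `P1` with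
a disjoint base point added. -/
def quotSpace (P1 P0 : Set Y) : PTop.{u} :=
  ⟨_root_.Quotient (collapse P1 P0), _root_.Quotient.mk _ (Sum.inr PUnit.unit)⟩

/-- The class `[x]` in `P1 / P0` of a point `x` of `P1`. -/
def quotMk (P1 P0 : Set Y) (x : P1) : (quotSpace P1 P0).carrier :=
  _root_.Quotient.mk (collapse P1 P0) (Sum.inl x)

theorem continuous_quotMk (P1 P0 : Set Y) : Continuous (quotMk P1 P0) :=
  Continuous.comp (g := fun a => (_root_.Quotient.mk (collapse P1 P0) a))
    continuous_quot_mk continuous_inl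

theorem quotMk_eq_pt {P1 P0 : Set Y} {x : P1} :
    quotMk P1 P0 x = (quotSpace P1 P0).pt ↔ x.1 ∈ P0 := by
  refine ⟨fun h => ?_, fun h => _root_.Quotient.sound (Or.inr ⟨h, trivial⟩)⟩
  rcases _root_.Quotient.exact h with h | h
  · cases h
  · exact h.1

open Classical in
/-- The index map on points of `P1`: `[h x]` if `h x ∈ P1`, and the base point otherwise. -/
noncomputable def indexMapPre (h : Y → Y) (P1 P0 : Set Y) (x : P1) :
    (quotSpace P1 P0).carrier :=
  if hx : h x.1 ∈ P1 then quotMk P1 P0 ⟨h x.1, hx⟩ else (quotSpace P1 P0).pt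

variable {h : C(Y, Y)} {S : Set Y}

theorem IndexPair.indexMapPre_of_mem (P : IndexPair h S) {x : P.P1} (hx : x.1 ∈ P.P0) :
    indexMapPre h P.P1 P.P0 x = (quotSpace P.P1 P.P0).pt := by
  unfold indexMapPre
  split_ifs with h1
  · refine quotMk_eq_pt.2 ?_
    by_contra h2
    exact P.exit_invariant _ hx ⟨h1, h2⟩
  · rfl

theorem IndexPair.continuous_indexMapPre [T2Space Y] (P : IndexPair h S) :
    Continuous (indexMapPre h P.P1 P.P0) := by
  refine continuous_def.2 fun V hV => ?_
  obtain ⟨W, hW, hWV⟩ := isOpen_induced_iff.1 (hV.preimage (continuous_quotMk P.P1 P.P0))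
  have key : ∀ y : P.P1, quotMk P.P1 P.P0 y ∈ V ↔ y.1 ∈ W := fun y => by
    have := Set.ext_iff.1 hWV y
    exact this.symm
  by_cases hb : (quotSpace P.P1 P.P0).pt ∈ V
  · have : indexMapPre h P.P1 P.P0 ⁻¹' V
        = Subtype.val ⁻¹' (h ⁻¹' (W ∪ P.P1ᶜ)) := by
      ext x
      by_cases hx : h x.1 ∈ P.P1
      · simp [indexMapPre, hx, key]
      · simp [indexMapPre, hx, hb]
    rw [this]
    exact ((hW.union P.compact_P1.isClosed.isOpen_compl).preimage h.continuous).preimage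
      continuous_subtype_val
  · have : indexMapPre h P.P1 P.P0 ⁻¹' V
        = Subtype.val ⁻¹' (h ⁻¹' W ∩ P.P0ᶜ) := by
      ext x
      by_cases hx0 : x.1 ∈ P.P0
      · simp [P.indexMapPre_of_mem hx0, hb, hx0]
      · have hx : h x.1 ∈ P.P1 := by
          by_contra hx
          exact hx0 (P.exit _ x.2 hx)
        simp [indexMapPre, hx, key, hx0]
    rw [this]
    exact ((hW.preimage h.continuous).inter P.compact_P0.isClosed.isOpen_compl).preimage
      continuous_subtype_val

/-- The index map `h_P : P1 / P0 → P1 / P0`. -/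
noncomputable def IndexPair.indexMap [T2Space Y] (P : IndexPair h S) :
    quotSpace P.P1 P.P0 ⟶ quotSpace P.P1 P.P0 where
  toMap :=
    { toFun := _root_.Quotient.lift
        (Sum.elim (indexMapPre h P.P1 P.P0) (fun _ => (quotSpace P.P1 P.P0).pt)) (by
          have base : ∀ a, IsBase P.P1 P.P0 a → Sum.elim (indexMapPre h P.P1 P.P0)
              (fun _ => (quotSpace P.P1 P.P0).pt) a = (quotSpace P.P1 P.P0).pt := by
            rintro (x | x) hx
            · exact P.indexMapPre_of_mem hx
            · rfl
          rintro a b (rfl | ⟨ha, hb⟩)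
          · rfl
          · rw [base a ha, base b hb])
      continuous_toFun := Continuous.quotient_lift
        (P.continuous_indexMapPre.sumElim continuous_const) _ }
  map_pt := rfl

/-- The Conley index of the isolated invariant set `S` of `h`: the class of all objects that are
isomorphic, in the Szymczak category over the pointed homotopy category, to `(P1 / P0, h_P)`
for an index pair `P` of `S`. -/
def conleyIndex [T2Space Y] (h : C(Y, Y)) (S : Set Y) : Set (Sz HoPTop.{u}) :=
  {Z | ∃ P : IndexPair h S, Nonempty (Z ≅ szObj (quotSpace P.P1 P.P0) P.indexMap)}

end Index

/-- The trivial Conley index: the isomorphism class of the one-point space. -/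
def trivialIndex : Set (Sz HoPTop.{u}) := {Z | Nonempty (Z ≅ trivialObj.{u})}

/-! ## Piecewise continuous maps -/

/-- A piecewise continuous self-map of `X` with a finite partition that cannot be coarsened.
`branch i` is the continuous extension to `closure (piece i)` of the restriction of the map to
`piece i`. -/
structure PCM (X : Type u) [TopologicalSpace X] where
  toFun : X → X
  n : ℕ
  piece : Fin n → Set X
  disjoint : ∀ i j, i ≠ j → Disjoint (piece i) (piece j)
  cover : ∀ x, ∃ i, x ∈ piece i
  branch : ∀ i, C(closure (piece i), X)
  branch_eq : ∀ i x (hx : x ∈ piece i), branch i ⟨x, subset_closure hx⟩ = toFun x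
  minimal : ∀ i j, i ≠ j → ¬ ∃ F : C(closure (piece i ∪ piece j), X),
    ∀ x (hx : x ∈ piece i ∪ piece j), F ⟨x, subset_closure hx⟩ = toFun x

namespace PCM

variable {X : Type u} [TopologicalSpace X] (f : PCM X)

/-- The discontinuity set `D`. -/
def discSet : Set X :=
  {x | ∃ i j, i ≠ j ∧ x ∈ closure (f.piece i) ∩ closure (f.piece j)}

/-- `g` is an adjoint map of `f`: there is an adjoint partition `B` of the partition of `f`,
matched to it by a permutation `φ`, such that `g` is the branch `f_i` on `B (φ i)`
(which has to lie in the domain `closure (piece i)` of `f_i`). -/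
def IsAdjoint (g : X → X) : Prop :=
  ∃ (B : Fin f.n → Set X) (φ : Equiv.Perm (Fin f.n)),
    (∀ i j, i ≠ j → Disjoint (B i) (B j)) ∧ (∀ x, ∃ i, x ∈ B i) ∧
    (∀ i, f.piece i \ f.discSet = B (φ i) \ f.discSet) ∧
    ∀ i, ∀ x ∈ B (φ i), ∃ hx : x ∈ closure (f.piece i), g x = f.branch i ⟨x, hx⟩

/-- `N` is an isolating neighborhood. -/
def IsIsolatingNbhd (N : Set X) : Prop :=
  IsCompact N ∧ Inv f.toFun N ⊆ interior N

/-- `N` is a compatible isolating neighborhood. -/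
def IsCompatibleIsolatingNbhd (N : Set X) : Prop :=
  f.IsIsolatingNbhd N ∧
    ∀ g : X → X, f.IsAdjoint g → frontier N ∩ f.discSet ∩ InvMinus g N = ∅

/-- The label of the piece that contains `x`. -/
noncomputable def label (x : X) : Fin f.n := (f.cover x).choose

theorem mem_piece_label (x : X) : x ∈ f.piece (f.label x) := (f.cover x).choose_spec

/-- The coding map `τ`; sequences carry the product topology of discrete spaces. -/
noncomputable def coding (x : X) : ℕ → Fin f.n := fun k => f.label (f.toFun^[k] x)

theorem coding_toFun (x : X) : f.coding (f.toFun x) = fun k => f.coding x (k + 1) := rfl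

/-- The graph `G_X` of the coding map. -/
def graph : Set (X × (ℕ → Fin f.n)) := {p | p.2 = f.coding p.1}

/-- The closure of the coding graph, as a space. -/
abbrev Lift : Type u := closure f.graph

/-- The point `(x, τ x)` of the coding graph. -/
noncomputable def lift (x : X) : f.Lift := ⟨(x, f.coding x), subset_closure rfl⟩

theorem denseRange_lift : DenseRange f.lift := by
  rw [DenseRange, Subtype.dense_iff]
  intro p hp
  refine closure_mono ?_ hp
  rintro ⟨x, s⟩ hs
  have hs' : s = f.coding x := hs
  subst hs'
  exact ⟨f.lift x, ⟨x, rfl⟩, rfl⟩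

theorem mem_closure_piece (p : f.Lift) : p.1.1 ∈ closure (f.piece (p.1.2 0)) := by
  have hopen : IsOpen {q : X × (ℕ → Fin f.n) | q.2 0 = p.1.2 0} :=
    (isOpen_discrete {p.1.2 0}).preimage
      ((continuous_apply (A := fun _ : ℕ => Fin f.n) 0).comp continuous_snd)
  have h1 : p.1 ∈ closure (f.graph ∩ {q | q.2 0 = p.1.2 0}) :=
    hopen.closure_inter ⟨p.2, rfl⟩
  have h2 : Prod.fst p.1 ∈ closure (Prod.fst '' (f.graph ∩ {q | q.2 0 = p.1.2 0})) :=
    image_closure_subset_closure_image continuous_fst ⟨_, h1, rfl⟩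
  refine closure_mono ?_ h2
  rintro _ ⟨⟨x, s⟩, ⟨hs, hs0⟩, rfl⟩
  have hs' : s = f.coding x := hs
  have hs0' : s 0 = p.1.2 0 := hs0
  rw [← hs0', hs']
  exact f.mem_piece_label x

/-- The lifted map in coordinates: `(x, s) ↦ (f_{s 0} x, shift s)`. -/
def liftMapPre (p : f.Lift) : X × (ℕ → Fin f.n) :=
  (f.branch (p.1.2 0) ⟨p.1.1, f.mem_closure_piece p⟩, fun k => p.1.2 (k + 1))

theorem liftMapPre_lift (x : X) :
    f.liftMapPre (f.lift x) = (f.toFun x, f.coding (f.toFun x)) :=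
  Prod.ext (f.branch_eq _ x (f.mem_piece_label x)) rfl

theorem continuous_liftMapPre : Continuous f.liftMapPre := by
  refine Continuous.prodMk ?_ (by fun_prop)
  refine continuous_iff_continuousAt.2 fun p₀ => ?_
  have hopen : IsOpen {q : f.Lift | q.1.2 0 = p₀.1.2 0} :=
    (isOpen_discrete {p₀.1.2 0}).preimage
      ((continuous_apply (A := fun _ : ℕ => Fin f.n) 0).comp
        (continuous_snd.comp continuous_subtype_val))
  refine ContinuousOn.continuousAt ?_ (hopen.mem_nhds rfl)
  rw [continuousOn_iff_continuous_domRestrict]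
  have aux : ∀ i j (hij : i = j) (x : X) (hi : x ∈ closure (f.piece i))
      (hj : x ∈ closure (f.piece j)), f.branch i ⟨x, hi⟩ = f.branch j ⟨x, hj⟩ := by
    rintro i _ rfl x hi hj; rfl
  have hmem : ∀ q : {q : f.Lift | q.1.2 0 = p₀.1.2 0},
      q.1.1.1 ∈ closure (f.piece (p₀.1.2 0)) := fun q => by
    have h1 := f.mem_closure_piece q.1
    have h2 : q.1.1.2 0 = p₀.1.2 0 := q.2
    rwa [h2] at h1
  have : Continuous fun q : {q : f.Lift | q.1.2 0 = p₀.1.2 0} =>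
      f.branch (p₀.1.2 0) ⟨q.1.1.1, hmem q⟩ :=
    (f.branch _).continuous.comp (Continuous.subtype_mk (by fun_prop) _)
  refine this.congr fun q => ?_
  exact aux _ _ q.2.symm _ _ _

theorem liftMapPre_mem (p : f.Lift) : f.liftMapPre p ∈ closure f.graph := by
  refine f.denseRange_lift.induction_on (p := fun p => f.liftMapPre p ∈ closure f.graph) p
    (isClosed_closure.preimage f.continuous_liftMapPre) fun x => ?_
  rw [f.liftMapPre_lift]
  exact subset_closure rfl

/-- The lifted map `f̂` on the closure of the coding graph. -/
def liftMap : C(f.Lift, f.Lift) where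
  toFun p := ⟨f.liftMapPre p, f.liftMapPre_mem p⟩
  continuous_toFun := f.continuous_liftMapPre.subtype_mk _

/-- `f̂` extends the graph map `(x, τ x) ↦ (f x, τ (f x))`. -/
theorem liftMap_lift (x : X) : f.liftMap (f.lift x) = f.lift (f.toFun x) :=
  Subtype.ext (f.liftMapPre_lift x)

/-- `f̂` is the only continuous extension of the graph map. -/
theorem liftMap_unique [T2Space X] (F : C(f.Lift, f.Lift))
    (hF : ∀ x, F (f.lift x) = f.lift (f.toFun x)) : F = f.liftMap :=
  DFunLike.coe_injective <| f.denseRange_lift.equalizer F.continuous f.liftMap.continuous <|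
    funext fun x => (hF x).trans (f.liftMap_lift x).symm

/-- `N̂`: the closure of the graph of the coding map over `N`. -/
def hat (N : Set X) : Set f.Lift := closure (f.lift '' N)

/-- The Conley index `C(N)` of `f` on `N`: the Conley index of `Inv(N̂)` for `f̂`. -/
def conleyIndexOn [T2Space X] (N : Set X) : Set (Sz HoPTop.{u}) :=
  conleyIndex f.liftMap (Inv f.liftMap (f.hat N))

end PCM

end ConleyPCM

/-!
The contrapositive splits according to whether `Inv f̂ N̂` is empty.

If `Inv f̂ N̂` is nonempty, a full `f̂`-orbit in `N̂` projects to a sequence `x k ∈ N` together with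
symbols `s k` such that `x k` lies in the closure of the piece `s k` and `x (k + 1)` is the value at
`x k` of the branch `s k`. Such a sequence is an orbit of an adjoint map as soon as `x k` determines
`s k`: use the symbol `s k` at the point `x k` and the original label elsewhere
(`PCM.isAdjoint_branchMap`). If the sequence visits no point twice this holds automatically;
otherwise a shortest loop of it, repeated periodically, has this property
(`PCM.BranchOrbit.exists_consistent`). The adjoint map obtained is either `f` itself or another one.

If `Inv f̂ N̂ = ∅`, the index is trivial: `(∅, ∅)` is an index pair for the empty set, and for
an arbitrary index pair `(P1, P0)` of the empty set, compactness bounds the length of the orbit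
segments in `closure (P1 \ P0)` (`exists_iterate_notMem_of_inv_eq_empty`), so that a power of the
index map is constant. In the Szymczak category such an object is isomorphic to the
one-point space.
-/

namespace ConleyPCM

open CategoryTheory

/-! ### Orbit segments in a compact set with empty invariant part -/

section Compactness

variable {Y : Type u} [TopologicalSpace Y] [T2Space Y]

/-- Arbitrarily long orbit segments in a compact set accumulate at a full orbit, so they do not
exist if the invariant part is empty. -/
theorem exists_iterate_notMem_of_inv_eq_empty (h : C(Y, Y)) {K : Set Y} (hK : IsCompact K)
    (hinv : Inv h K = ∅) : ∃ m : ℕ, ∀ x, ∃ i ≤ m, h^[i] x ∉ K := by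
  by_contra! hcon
  -- `T n` consists of the bi-infinite sequences in `K` that are orbits at the times `-n ≤ k < n`.
  let T : ℕ → Set (ℤ → Y) := fun n =>
    Set.pi Set.univ (fun _ => K) ∩ {o | ∀ k : ℤ, -n ≤ k → k < n → h (o k) = o (k + 1)}
  have hpi : IsCompact (Set.pi Set.univ (fun _ : ℤ => K)) := isCompact_univ_pi fun _ => hK
  have hclosed : ∀ n, IsClosed (T n) := by
    intro n
    refine hpi.isClosed.inter ?_
    simp only [Set.ofPred_forall]
    exact isClosed_iInter fun k => isClosed_iInter fun _ => isClosed_iInter fun _ =>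
      isClosed_eq (h.continuous.comp (continuous_apply k)) (continuous_apply (k + 1))
  have hne : ∀ n, (T n).Nonempty := by
    intro n
    obtain ⟨x, hx⟩ := hcon (2 * n)
    refine ⟨fun k => h^[min (k + n).toNat (2 * n)] x, fun k _ => hx _ (min_le_right _ _), ?_⟩
    intro k hk hk'
    have e : min (k + 1 + n).toNat (2 * n) = min (k + n).toNat (2 * n) + 1 := by omega
    simp only [e, Function.iterate_succ_apply']
  obtain ⟨o, ho⟩ := IsCompact.nonempty_iInter_of_sequence_nonempty_isCompact_isClosed T
    (fun n o ho => ⟨ho.1, fun k hk hk' => ho.2 k (by push_cast; omega) (by push_cast; omega)⟩)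
    hne (hpi.of_isClosed_subset (hclosed 0) Set.inter_subset_left) hclosed
  rw [Set.mem_iInter] at ho
  have : o 0 ∈ Inv h K := by
    refine ⟨o, fun k => (ho 0).1 k trivial, rfl, fun k => ?_⟩
    exact (ho (k.natAbs + 1)).2 k (by omega) (by omega)
  rw [hinv] at this
  exact this

end Compactness

/-! ### Nilpotent pointed maps are trivial in the Szymczak category -/

/-- The constant map to the base point. -/
def PTop.const (A B : PTop.{u}) : A ⟶ B := (⟨ContinuousMap.const _ B.pt, rfl⟩ : PTop.Hom A B)

theorem PTop.hom_ext {A B : PTop.{u}} {f g : A ⟶ B}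
    (h : ∀ x, PTop.Hom.toMap f x = PTop.Hom.toMap g x) : f = g := by
  have aux : ∀ F G : PTop.Hom A B, F.toMap = G.toMap → F = G := by
    rintro ⟨F, _⟩ ⟨G, _⟩ rfl
    rfl
  exact aux f g (ContinuousMap.ext h)

theorem exists_iter_szObj_eq (A : PTop.{u}) (f : A ⟶ A) (m : ℕ) :
    ∃ F : A ⟶ A, (szObj A f).iter m = (Quotient.functor pointedHomotopic).map F ∧
      ∀ x, PTop.Hom.toMap F x = (PTop.Hom.toMap f)^[m] x := by
  induction m with
  | zero => exact ⟨𝟙 A, ((Quotient.functor pointedHomotopic).map_id A).symm, fun x => rfl⟩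
  | succ m ih =>
    obtain ⟨F, hF, hx⟩ := ih
    refine ⟨f ≫ F, ?_, fun x => hx _⟩
    rw [Sz.iter_succ, hF]
    exact ((Quotient.functor pointedHomotopic).map_comp f F).symm

theorem szObj_iso_trivialObj (A : PTop.{u}) (f : A ⟶ A) (m : ℕ)
    (hm : ∀ x, (PTop.Hom.toMap f)^[m] x = A.pt) : Nonempty (szObj A f ≅ trivialObj.{u}) := by
  let Q := Quotient.functor pointedHomotopic.{u}
  let φ : Sz.Equivariant (szObj A f) trivialObj :=
    ⟨Q.map (PTop.const A onePoint),
      (Q.map_comp _ _).symm.trans ((congrArg Q.map (PTop.hom_ext fun _ => rfl)).trans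
        (Q.map_comp _ _))⟩
  let ψ : Sz.Equivariant trivialObj (szObj A f) :=
    ⟨Q.map (PTop.const onePoint A),
      (Q.map_comp _ _).symm.trans ((congrArg Q.map
        (PTop.hom_ext fun _ => (PTop.Hom.map_pt f).symm)).trans (Q.map_comp _ _))⟩
  refine ⟨⟨_root_.Quotient.mk _ (φ, 0), _root_.Quotient.mk _ (ψ, 0), ?_, ?_⟩⟩
  · refine _root_.Quotient.sound ⟨m, ?_⟩
    obtain ⟨F, hF, hx⟩ := exists_iter_szObj_eq A f m
    have hFc : F = PTop.const A A := PTop.hom_ext fun x => (hx x).trans (hm x)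
    have h0 : (szObj A f).iter (0 + m) = Q.map (PTop.const A A) := by
      rw [Nat.zero_add, hF, hFc]
    change (szObj A f).iter (0 + m) ≫ 𝟙 _ =
      (szObj A f).iter (0 + m) ≫ Q.map (PTop.const A onePoint) ≫ Q.map (PTop.const onePoint A)
    rw [h0]
    refine (Category.comp_id (Q.map (PTop.const A A))).trans (Eq.trans ?_ <|
      (Q.map_comp _ _).trans (congrArg (Q.map _ ≫ ·) (Q.map_comp _ _)))
    exact congrArg Q.map (PTop.hom_ext fun _ => rfl)
  · refine _root_.Quotient.sound ⟨0, ?_⟩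
    refine congrArg (trivialObj.iter 0 ≫ ·) ?_
    change 𝟙 _ = Q.map (PTop.const onePoint A) ≫ Q.map (PTop.const A onePoint)
    refine ((Q.map_id _).symm.trans ?_).trans (Q.map_comp _ _)
    exact congrArg Q.map (PTop.hom_ext fun _ => rfl)

/-! ### The Conley index of the empty set -/

section Index

variable {Y : Type u} [TopologicalSpace Y] [T2Space Y] {h : C(Y, Y)}

/-- A point of `P1` whose class is not sent to the base point by the `m`-th power of the index map
has its first `m` iterates in `P1 \ P0`. -/
theorem IndexPair.iterate_mem {S : Set Y} (P : IndexPair h S) (m : ℕ) (x : P.P1)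
    (hx : (PTop.Hom.toMap P.indexMap)^[m] (quotMk P.P1 P.P0 x) ≠ (quotSpace P.P1 P.P0).pt) :
    ∀ i ≤ m, h^[i] x.1 ∈ P.P1 \ P.P0 := by
  have hfix : ∀ m, (PTop.Hom.toMap P.indexMap)^[m] (quotSpace P.P1 P.P0).pt
      = (quotSpace P.P1 P.P0).pt :=
    fun m => Function.iterate_fixed (PTop.Hom.map_pt P.indexMap) m
  have hx0 : x.1 ∉ P.P0 := fun h0 => hx (by rw [quotMk_eq_pt.2 h0]; exact hfix m)
  induction m generalizing x with
  | zero =>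
    intro i hi
    obtain rfl : i = 0 := by omega
    exact ⟨x.2, hx0⟩
  | succ m ih =>
    rw [Function.iterate_succ_apply] at hx
    have hval : PTop.Hom.toMap P.indexMap (quotMk P.P1 P.P0 x) = indexMapPre h P.P1 P.P0 x := rfl
    have h1 : h x.1 ∈ P.P1 := by
      by_contra h1
      exact hx0 (P.exit _ x.2 h1)
    rw [hval, indexMapPre, dif_pos h1] at hx
    have h2 : h x.1 ∉ P.P0 := fun h0 => hx (by rw [quotMk_eq_pt.2 h0]; exact hfix m)
    rintro (_ | i) hi
    · exact ⟨x.2, hx0⟩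
    · exact ih ⟨h x.1, h1⟩ hx h2 i (by omega)

theorem IndexPair.szObj_iso_trivialObj (P : IndexPair h ∅) :
    Nonempty (szObj (quotSpace P.P1 P.P0) P.indexMap ≅ trivialObj.{u}) := by
  have hK : IsCompact (closure (P.P1 \ P.P0)) :=
    P.compact_P1.closure_of_subset Set.sdiff_subset
  obtain ⟨m, hm⟩ := exists_iterate_notMem_of_inv_eq_empty h hK P.inv_eq
  refine ConleyPCM.szObj_iso_trivialObj _ _ m fun q => ?_
  obtain ⟨a, rfl⟩ := _root_.Quotient.exists_rep q
  rcases a with x | _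
  · by_contra hx
    obtain ⟨i, hi, hi'⟩ := hm x.1
    exact hi' (subset_closure (P.iterate_mem m x hx i hi))
  · exact Function.iterate_fixed (PTop.Hom.map_pt P.indexMap) m

theorem conleyIndex_empty (h : C(Y, Y)) : conleyIndex h ∅ = trivialIndex.{u} := by
  ext Z
  constructor
  · rintro ⟨P, ⟨e⟩⟩
    obtain ⟨e'⟩ := P.szObj_iso_trivialObj
    exact ⟨e.trans e'⟩
  · rintro ⟨e⟩
    let P : IndexPair h ∅ :=
      { P1 := ∅
        P0 := ∅
        compact_P1 := isCompact_empty
        compact_P0 := isCompact_empty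
        subset := subset_rfl
        inv_eq := by
          refine Set.eq_empty_of_forall_notMem ?_
          rintro _ ⟨o, ho, -⟩
          simpa using ho 0
        isolating := Set.empty_subset _
        exit_invariant := fun _ hx => hx.elim
        exit := fun _ hx => hx.elim }
    obtain ⟨e'⟩ := P.szObj_iso_trivialObj
    exact ⟨P, ⟨e.trans e'.symm⟩⟩

end Index

/-! ### Adjoint maps and orbits of branches -/

namespace PCM

variable {X : Type u} [TopologicalSpace X] (f : PCM X)

theorem branch_congr {i j : Fin f.n} (hij : i = j) {x y : X} (hxy : x = y)
    (hi : x ∈ closure (f.piece i)) (hj : y ∈ closure (f.piece j)) :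
    f.branch i ⟨x, hi⟩ = f.branch j ⟨y, hj⟩ := by
  subst hij hxy
  rfl

theorem eq_of_mem_closure_of_notMem_discSet {x : X} (hx : x ∉ f.discSet) {i j : Fin f.n}
    (hi : x ∈ closure (f.piece i)) (hj : x ∈ closure (f.piece j)) : i = j := by
  by_contra hij
  exact hx ⟨i, j, hij, hi, hj⟩

/-- The map that applies at each point `x` the branch `c x`, for a relabelling `c` of the points
compatible with the closures of the pieces. -/
def branchMap (c : X → Fin f.n) (hc : ∀ x, x ∈ closure (f.piece (c x))) (x : X) : X :=
  f.branch (c x) ⟨x, hc x⟩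

theorem isAdjoint_branchMap (c : X → Fin f.n) (hc : ∀ x, x ∈ closure (f.piece (c x))) :
    f.IsAdjoint (f.branchMap c hc) := by
  refine ⟨fun i => {x | c x = i}, Equiv.refl _, fun i j hij => ?_, fun x => ⟨c x, rfl⟩,
    fun i => ?_, ?_⟩
  · exact Set.disjoint_left.2 fun x (hi : c x = i) (hj : c x = j) => hij (hi.symm.trans hj)
  · ext x
    refine and_congr_left fun hx => ⟨fun hi => ?_, fun hi => ?_⟩
    · exact f.eq_of_mem_closure_of_notMem_discSet hx (hc x) (subset_closure hi)
    · have hi' : c x = i := hi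
      have hl := f.eq_of_mem_closure_of_notMem_discSet hx
        (subset_closure (f.mem_piece_label x)) (hc x)
      rw [← hi', ← hl]
      exact f.mem_piece_label x
  · rintro i x (rfl : c x = i)
    exact ⟨hc x, rfl⟩

/-- A bi-infinite sequence `x` of points of `N` with symbols `s`, each point being sent to the next
one by the branch that its symbol selects. -/
structure BranchOrbit (N : Set X) where
  x : ℤ → X
  s : ℤ → Fin f.n
  mem : ∀ k, x k ∈ N
  mem_closure : ∀ k, x k ∈ closure (f.piece (s k))
  step : ∀ k, f.branch (s k) ⟨x k, mem_closure k⟩ = x (k + 1)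

variable {f} {N : Set X}

/-- Repeating the segment of a branch orbit between two visits of a point. -/
def BranchOrbit.loop (o : f.BranchOrbit N) (k : ℤ) (p : ℕ) (hp : 0 < p)
    (hk : o.x k = o.x (k + p)) : f.BranchOrbit N where
  x j := o.x (k + j % p)
  s j := o.s (k + j % p)
  mem _ := o.mem _
  mem_closure _ := o.mem_closure _
  step j := by
    refine (o.step _).trans ?_
    have h1 : 0 ≤ j % p := Int.emod_nonneg _ (by omega)
    have h2 : j % p < p := Int.emod_lt_of_pos _ (by omega)
    have h3 : (j + 1) % p = (j % p + 1) % p := by simp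
    rw [h3]
    rcases (show j % p + 1 < p ∨ j % p + 1 = p by omega) with h | h
    · rw [Int.emod_eq_of_lt (by omega) h, add_assoc]
    · rw [add_assoc, h, Int.emod_self, add_zero, hk]

/-- If there is a branch orbit in `N`, there is one in which the symbol is a function of the
point. -/
theorem BranchOrbit.exists_consistent (o : f.BranchOrbit N) :
    ∃ o' : f.BranchOrbit N, ∀ k l, o'.x k = o'.x l → o'.s k = o'.s l := by
  classical
  by_cases hrep : ∃ p : ℕ, 0 < p ∧ ∃ k : ℤ, o.x k = o.x (k + p)
  · obtain ⟨hp, k, hk⟩ := Nat.find_spec hrep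
    have hmin := fun q => Nat.find_min (m := q) hrep
    generalize Nat.find hrep = p at hp hk hmin
    -- By minimality of the period no point occurs twice in the loop.
    have key : ∀ a b : ℤ, 0 ≤ a → b < p → a < b → o.x (k + a) ≠ o.x (k + b) := by
      intro a b ha hb hab he
      refine hmin (b - a).toNat (by omega) ⟨by omega, k + a, ?_⟩
      rw [he]
      congr 1
      omega
    refine ⟨o.loop k p hp hk, fun i j hij => ?_⟩
    change o.x (k + i % p) = o.x (k + j % p) at hij
    change o.s (k + i % p) = o.s (k + j % p)
    have hi := Int.emod_nonneg i (b := p) (by omega)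
    have hj := Int.emod_nonneg j (b := p) (by omega)
    have hi' := Int.emod_lt_of_pos i (b := p) (by omega)
    have hj' := Int.emod_lt_of_pos j (b := p) (by omega)
    rcases lt_trichotomy (i % (p : ℤ)) (j % p) with hlt | heq | hlt
    · exact (key _ _ hi hj' hlt hij).elim
    · rw [heq]
    · exact (key _ _ hj hi' hlt hij.symm).elim
  · have key : ∀ a b : ℤ, a < b → o.x a ≠ o.x b := by
      intro a b hab he
      refine hrep ⟨(b - a).toNat, by omega, a, ?_⟩
      rw [he]
      congr 1
      omega
    refine ⟨o, fun i j hij => ?_⟩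
    rcases lt_trichotomy i j with hlt | heq | hlt
    · exact (key _ _ hlt hij).elim
    · rw [heq]
    · exact (key _ _ hlt hij.symm).elim

theorem BranchOrbit.exists_isAdjoint (o : f.BranchOrbit N) :
    ∃ g : X → X, f.IsAdjoint g ∧ (Inv g N).Nonempty := by
  classical
  obtain ⟨o, ho⟩ := o.exists_consistent
  let c : X → Fin f.n := fun y => if hy : ∃ k, o.x k = y then o.s hy.choose else f.label y
  have hcx : ∀ k, c (o.x k) = o.s k := by
    intro k
    have hy : ∃ l, o.x l = o.x k := ⟨k, rfl⟩
    exact (dif_pos hy).trans (ho _ _ hy.choose_spec)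
  have hc : ∀ y, y ∈ closure (f.piece (c y)) := by
    intro y
    by_cases hy : ∃ k, o.x k = y
    · obtain ⟨k, rfl⟩ := hy
      rw [hcx]
      exact o.mem_closure k
    · rw [show c y = f.label y from dif_neg hy]
      exact subset_closure (f.mem_piece_label y)
  exact ⟨f.branchMap c hc, f.isAdjoint_branchMap c hc, o.x 0, o.x, o.mem, rfl, fun k =>
    (f.branch_congr (hcx k) rfl (hc _) (o.mem_closure k)).trans (o.step k)⟩

variable (f) in
theorem fst_mem_of_mem_hat (hN : IsClosed N) {p : f.Lift} (hp : p ∈ f.hat N) : p.1.1 ∈ N := by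
  have hcl : IsClosed {q : f.Lift | q.1.1 ∈ N} :=
    hN.preimage (continuous_fst.comp continuous_subtype_val)
  refine closure_minimal ?_ hcl hp
  rintro _ ⟨x, hx, rfl⟩
  exact hx

variable (f) in
/-- The projection of a full orbit of the lifted map in `N̂` is a branch orbit in `N`. -/
theorem exists_branchOrbit (hN : IsClosed N) (h : (Inv f.liftMap (f.hat N)).Nonempty) :
    Nonempty (f.BranchOrbit N) := by
  obtain ⟨_, o, ho, -, hstep⟩ := h
  exact ⟨{ x := fun k => (o k).1.1
           s := fun k => (o k).1.2 0
           mem := fun k => f.fst_mem_of_mem_hat hN (ho k)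
           mem_closure := fun k => f.mem_closure_piece (o k)
           step := fun k => congrArg (fun q : f.Lift => q.1.1) (hstep k) }⟩

end PCM

end ConleyPCM

theorem mainTheorem1 {X : Type*} [MetricSpace X] [LocallyCompactSpace X]
    (f : ConleyPCM.PCM X) (N : Set X) (hN : f.IsCompatibleIsolatingNbhd N)
    (hC : f.conleyIndexOn N ≠ ConleyPCM.trivialIndex) :
    (ConleyPCM.Inv f.toFun N).Nonempty ∨
      ∃ g : X → X, f.IsAdjoint g ∧ g ≠ f.toFun ∧ (ConleyPCM.Inv g N).Nonempty := by
  have hne : (ConleyPCM.Inv f.liftMap (f.hat N)).Nonempty := by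
    by_contra hempty
    refine hC ?_
    rw [ConleyPCM.PCM.conleyIndexOn, Set.not_nonempty_iff_eq_empty.1 hempty]
    exact ConleyPCM.conleyIndex_empty _
  obtain ⟨o⟩ := f.exists_branchOrbit hN.1.1.isClosed hne
  obtain ⟨g, hg, hgN⟩ := o.exists_isAdjoint
  by_cases hgf : g = f.toFun
  · exact Or.inl (hgf ▸ hgN)
  · exact Or.inr ⟨g, hg, hgf, hgN⟩
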